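/- Let $f:[0,1]\to[0,1]$ be continuous and suppose that $f$ has a cycle of (least) period $m\cdot p$, where $p>1$ is odd and $m$ is a power of two (possibly $m=1$). Let $\rho>1$ be the root greater than one of $\lambda^{p-1}-\lambda^{p-2}-1=0$. For a threshold $\theta$ and labelled points $(x_i,y_i)_{i=1}^{N}$ with $x_i\in[0,1]$, $y_i\in\{0,1\}$, the classification error of $g:[0,1]\to\mathbb R$ is $$\mathcal R(g)=\frac1N\sum_{i=1}^{N}\mathbf 1\big[\tilde g(x_i)\ne y_i\big],\qquad \tilde g(z)=\mathbf 1[g(z)\ge\theta].$$ A ReLU network with $l\ge1$ layers and $u\ge1$ nodes per layer is a function $g:\mathbb R\to\mathbb R$ obtained by composing $l$ layers of $u$ nodes each, where every node applies $v\mapsto\max(v,0)$ to an affine function of the outputs of the previous layer (of the input, for the first layer), followed by an affine read-out of the last layer. Then there are $a<b$ in $[0,1]$ such that, with the threshold $\theta=\frac{a+b}{2}$, the following holds for every integer $k\ge1$. Put $n=\lfloor\rho^k\rfloor/2$ (so $2n=\lfloor\rho^k\rfloor$ is an integer). There are points $x_1<x_2<\dots<x_{2n}$ in $[0,1]$ with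 labels $y_j=0$ for $j$ odd and $y_j=1$ for $j$ even, where $f^{mk}$ ($f$ composed with itself $mk$ times) takes the value $a$ at the points labelled $0$ and $b$ at the points labelled $1$, such that $\mathcal R(f^{mk})=0$, whereas for all integers $l,u\ge1$ with $u\le\rho^{k/l}/8$, every ReLU network $g$ with $l$ layers and $u$ nodes per layer satisfies $\mathcal R(g)\ge\frac14$. -/

import Mathlib

open scoped unitInterval

noncomputable section

/-- The classifier `𝟏[v ≥ θ]` with threshold `θ`, as a label in `{0, 1}`. -/
def thresholdLabel (θ v : ℝ) : Fin 2 := if θ ≤ v then 1 else 0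

/-- Classification error of `g : [0,1] → ℝ`, thresholded at `θ`, on the labelled points
`(x i, y i)`: the fraction of the points that are misclassified. -/
def classificationError {N : ℕ} (θ : ℝ) (x : Fin N → I) (y : Fin N → Fin 2) (g : I → ℝ) : ℝ :=
  (1 / (N : ℝ)) * ∑ i : Fin N, if thresholdLabel θ (g (x i)) ≠ y i then (1 : ℝ) else 0

/-- Parameters (weights and biases) of `l ≥ 1` successive fully connected layers with `u` nodes
each, on a one-dimensional input. -/
inductive HiddenLayers (u : ℕ) : ℕ → Type
  | first (w b : Fin u → ℝ) : HiddenLayers u 1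
  | next {l : ℕ} (H : HiddenLayers u l) (W : Matrix (Fin u) (Fin u) ℝ) (b : Fin u → ℝ) :
      HiddenLayers u (l + 1)

/-- Outputs of the last layer; every node applies the ReLU activation `v ↦ max v 0` to an affine
function of the outputs of the previous layer. -/
def HiddenLayers.eval {u : ℕ} : {l : ℕ} → HiddenLayers u l → ℝ → Fin u → ℝ
  | _, .first w b, z => fun i => max (w i * z + b i) 0
  | _, .next H W b, z => fun i => max ((∑ j, W i j * H.eval z j) + b i) 0

/-- A ReLU network with scalar input and output, with `l` layers of `u` ReLU nodes each, followed
by an affine read-out. -/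
structure ReLUNetwork (l u : ℕ) where
  hidden : HiddenLayers u l
  c : Fin u → ℝ
  d : ℝ

/-- The function computed by the network. -/
def ReLUNetwork.eval {l u : ℕ} (G : ReLUNetwork l u) (z : ℝ) : ℝ :=
  (∑ i, G.c i * G.hidden.eval z i) + G.d

end

/-!
A function which is affine on each of `P` consecutive intervals changes its thresholded label at
most `2 P - 1` times, and a layer of `u` ReLU nodes multiplies the number of intervals by at most
`u + 1`. A network with few nodes therefore gives equal labels to many adjacent sample points,
one of which is misclassified when the true labels alternate.

For `h = f^[m]`, which has a cycle of odd period `p`, consider the basic intervals between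
consecutive points of the cycle. Some basic interval `J` has its ends exchanged in order by `h`, so
it covers itself and, after `p - 2` steps, every basic interval; as `p` is odd, a second basic
interval also covers `J`. Hence the number `u k` of paths of length `k` ending at `J` satisfies
`u (k + p - 1) ≥ u (k + p - 2) + u k`, which gives `u k ≥ ρ ^ k`. Each such path yields a crossing
of `J` by `h^[k]`, and the crossings supply the alternating sample points.
-/

/-- `v` is affine on each class of a partition of the line into `P` consecutive (possibly empty)
pieces; the partition is encoded as a monotone labelling `ℝ → Fin P`, so that it does not matter
to which of two adjacent pieces a breakpoint belongs. -/
def IsPiecewiseAffine {E : Type*} [AddCommGroup E] [Module ℝ E] (P : ℕ) (v : ℝ → E) : Prop :=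
  ∃ c : ℝ → Fin P, Monotone c ∧ ∀ j, ∃ A : ℝ →ᵃ[ℝ] E, Set.EqOn v A (c ⁻¹' {j})

section PiecewiseAffine

variable {E F ι : Type*} [AddCommGroup E] [Module ℝ E] [AddCommGroup F] [Module ℝ F] [Fintype ι]
  {P : ℕ}

/-- On each class of `c`, the family of the predicates that have switched value is increasing, so
its cardinality separates the points at which some predicate differs. -/
lemma exists_monotone_refinement {α κ : Type*} [LinearOrder α] [PartialOrder κ] {c : α → κ}
    (hc : Monotone c) (S : ι → α → Prop)
    (hS : ∀ i j, MonotoneOn (S i) (c ⁻¹' {j}) ∨ AntitoneOn (S i) (c ⁻¹' {j})) :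
    ∃ c' : α → κ ×ₗ Fin (Fintype.card ι + 1), Monotone c' ∧
      ∀ z z', c' z = c' z' → c z = c z' ∧ ∀ i, S i z ↔ S i z' := by
  classical
  let switched (z : α) : Finset ι := {i | S i z ↔ MonotoneOn (S i) (c ⁻¹' {c z})}
  have switched_subset {z z' : α} (hz : z ≤ z') (hcz : c z = c z') :
      switched z ⊆ switched z' := by
    intro i hi
    simp only [switched, Finset.mem_filter, Finset.mem_univ, true_and, ← hcz] at hi ⊢
    rcases em (MonotoneOn (S i) (c ⁻¹' {c z})) with hm | hm
    · exact iff_of_true (hm rfl hcz.symm hz (hi.mpr hm)) hm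
    · have ha := (hS i (c z)).resolve_left hm
      exact iff_of_false (fun h => hm (hi.mp (ha rfl hcz.symm hz h))) hm
  refine ⟨fun z => toLex (c z, ⟨(switched z).card, Nat.lt_succ_of_le (switched z).card_le_univ⟩),
    fun z z' hz => Prod.Lex.toLex_le_toLex'.mpr
      ⟨hc hz, fun hcz => Finset.card_le_card (switched_subset hz hcz)⟩, fun z z' h => ?_⟩
  wlog hz : z ≤ z' generalizing z z'
  · obtain ⟨hcz, hSz⟩ := this z' z h.symm (le_of_not_ge hz)
    exact ⟨hcz.symm, fun i => (hSz i).symm⟩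
  obtain ⟨hcz, hcard⟩ : c z = c z' ∧ (switched z).card = (switched z').card := by simpa using h
  have hswitched : switched z = switched z' :=
    Finset.eq_of_subset_of_card_le (switched_subset hz hcz) hcard.ge
  refine ⟨hcz, fun i => ?_⟩
  have hi : i ∈ switched z ↔ i ∈ switched z' := by rw [hswitched]
  simp only [switched, Finset.mem_filter, Finset.mem_univ, true_and, hcz] at hi
  tauto

lemma monotone_or_antitone_affineMap (A : ℝ →ᵃ[ℝ] ℝ) : Monotone A ∨ Antitone A := by
  have hA : ⇑A = AffineMap.lineMap (A 0) (A 1) := by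
    ext z
    rw [← AffineMap.apply_lineMap, AffineMap.lineMap_apply_ring']
    simp
  rw [hA]
  exact (le_total (A 0) (A 1)).imp (fun h => AffineMap.lineMap_mono h)
    fun h => AffineMap.lineMap_anti h

lemma monotoneOn_or_antitoneOn_le_of_eqOn_affineMap {s : Set ℝ} {v : ℝ → ℝ} {A : ℝ →ᵃ[ℝ] ℝ}
    (hv : Set.EqOn v A s) (θ : ℝ) :
    MonotoneOn (fun z => θ ≤ v z) s ∨ AntitoneOn (fun z => θ ≤ v z) s :=
  (monotone_or_antitone_affineMap A).imp
    (fun hA _ hz _ hz' hzz h => h.trans (((hA.monotoneOn s).congr hv.symm) hz hz' hzz))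
    fun hA _ hz _ hz' hzz h => h.trans (((hA.antitoneOn s).congr hv.symm) hz hz' hzz)

lemma isPiecewiseAffine_affineMap (A : ℝ →ᵃ[ℝ] E) : IsPiecewiseAffine 1 A :=
  ⟨fun _ => 0, monotone_const, fun _ => ⟨A, Set.eqOn_refl _ _⟩⟩

namespace IsPiecewiseAffine

lemma affineMap_comp {v : ℝ → E} (hv : IsPiecewiseAffine P v) (B : E →ᵃ[ℝ] F) :
    IsPiecewiseAffine P (B ∘ v) := by
  obtain ⟨c, hc, hA⟩ := hv
  refine ⟨c, hc, fun j => ?_⟩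
  obtain ⟨A, hA⟩ := hA j
  exact ⟨B.comp A, hA.comp_left⟩

lemma exists_sign_labelling {v : ℝ → ι → ℝ} (hv : IsPiecewiseAffine P v) (θ : ℝ) :
    ∃ c : ℝ → Fin (P * (Fintype.card ι + 1)), Monotone c ∧
      ∀ j, ∃ A : ℝ →ᵃ[ℝ] (ι → ℝ), Set.EqOn v A (c ⁻¹' {j}) ∧
        ∀ z ∈ c ⁻¹' {j}, ∀ z' ∈ c ⁻¹' {j}, ∀ i, θ ≤ v z i ↔ θ ≤ v z' i := by
  obtain ⟨c, hc, hA⟩ := hv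
  choose A hA using hA
  obtain ⟨c', hc', hcls⟩ := exists_monotone_refinement hc (fun i z => θ ≤ v z i) fun i j =>
    monotoneOn_or_antitoneOn_le_of_eqOn_affineMap (A := (AffineMap.proj i).comp (A j))
      (fun z hz => congrFun (hA j hz) i) θ
  let e : Fin P ×ₗ Fin (Fintype.card ι + 1) ≃o Fin (P * (Fintype.card ι + 1)) :=
    (Fintype.orderIsoFinOfCardEq _ (by simp [Fintype.card_lex])).symm
  have hcls' {z z' : ℝ} (h : e (c' z) = e (c' z')) := hcls z z' (e.injective h)
  refine ⟨e ∘ c', e.monotone.comp hc', fun j => ?_⟩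
  rcases ((e ∘ c') ⁻¹' {j}).eq_empty_or_nonempty with hj | ⟨z₀, hz₀⟩
  · simp [hj]
  · exact ⟨A (c z₀), fun z hz => hA (c z₀) (hcls' (hz.trans hz₀.symm)).1,
      fun z hz z' hz' => (hcls' (hz.trans hz'.symm)).2⟩

lemma relu {v : ℝ → ι → ℝ} (hv : IsPiecewiseAffine P v) :
    IsPiecewiseAffine (P * (Fintype.card ι + 1)) fun z i => max (v z i) 0 := by
  classical
  obtain ⟨c, hc, hA⟩ := hv.exists_sign_labelling 0
  refine ⟨c, hc, fun j => ?_⟩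
  obtain ⟨A, hA, hsign⟩ := hA j
  rcases (c ⁻¹' {j}).eq_empty_or_nonempty with hj | ⟨z₀, hz₀⟩
  · simp [hj]
  refine ⟨AffineMap.pi fun i => if 0 ≤ v z₀ i then (AffineMap.proj i).comp A else 0,
    fun z hz => funext fun i => ?_⟩
  by_cases hi : 0 ≤ v z₀ i
  · simp [hi, ← hA hz, (hsign z hz z₀ hz₀ i).mpr hi]
  · simp [hi, (not_le.mp (mt (hsign z hz z₀ hz₀ i).mp hi)).le]

lemma exists_labelling_threshold {g : ℝ → ℝ} (hg : IsPiecewiseAffine P g) (θ : ℝ) :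
    ∃ c : ℝ → Fin (P * 2), Monotone c ∧
      ∀ z z', c z = c z' → thresholdLabel θ (g z) = thresholdLabel θ (g z') := by
  obtain ⟨c, hc, hA⟩ := (hg.affineMap_comp
    (AffineMap.pi fun _ : Unit => AffineMap.id ℝ ℝ)).exists_sign_labelling θ
  refine ⟨c, hc, fun z z' h => ?_⟩
  obtain ⟨-, -, hsign⟩ := hA (c z')
  have hiff : θ ≤ g z ↔ θ ≤ g z' := hsign z h z' rfl ()
  simp only [thresholdLabel, hiff]

end IsPiecewiseAffine

lemma HiddenLayers.isPiecewiseAffine_eval {l u : ℕ} (H : HiddenLayers u l) :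
    IsPiecewiseAffine ((u + 1) ^ l) H.eval := by
  induction H with
  | first w b =>
    have h := (isPiecewiseAffine_affineMap
      ((LinearMap.toSpanSingleton ℝ (Fin u → ℝ) w).toAffineMap + AffineMap.const ℝ ℝ b)).relu
    simpa [HiddenLayers.eval, mul_comm] using h
  | next H W b ih =>
    have h := (ih.affineMap_comp (W.mulVecLin.toAffineMap + AffineMap.const ℝ _ b)).relu
    rwa [Fintype.card_fin, ← pow_succ] at h

lemma ReLUNetwork.isPiecewiseAffine_eval {l u : ℕ} (G : ReLUNetwork l u) :
    IsPiecewiseAffine ((u + 1) ^ l) G.eval :=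
  G.hidden.isPiecewiseAffine_eval.affineMap_comp
    ((dotProductBilin ℝ ℝ G.c).toAffineMap + AffineMap.const ℝ (Fin u → ℝ) G.d)

end PiecewiseAffine

section Classification

lemma card_filter_castSucc_lt_succ_lt_card {κ : Type*} [LinearOrder κ] [Fintype κ] {n : ℕ}
    {d : Fin (n + 1) → κ} (hd : Monotone d) :
    ({i | d i.castSucc < d i.succ} : Finset (Fin n)).card < Fintype.card κ := by
  have hinj : Set.InjOn (fun i : Fin n => d i.succ) {i | d i.castSucc < d i.succ} :=
    StrictMonoOn.injOn fun i _ j hj hij =>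
      (hd (Fin.succ_le_castSucc_iff.mpr hij)).trans_lt hj
  rw [← Finset.card_image_of_injOn (by simpa using hinj), ← Finset.card_univ]
  refine Finset.card_lt_card (Finset.ssubset_univ_iff.mpr fun huniv => ?_)
  obtain ⟨i, hi, h0⟩ := Finset.mem_image.mp (huniv ▸ Finset.mem_univ (d 0))
  exact (hd (Fin.zero_le i.castSucc)).not_gt (h0 ▸ (Finset.mem_filter.mp hi).2)

lemma lt_card_add_two_mul_card {κ : Type*} [LinearOrder κ] [Fintype κ] {n : ℕ}
    {d : Fin (n + 1) → κ} (hd : Monotone d) {wrong : Finset (Fin (n + 1))}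
    (h : ∀ i : Fin n, d i.castSucc = d i.succ → i.castSucc ∈ wrong ∨ i.succ ∈ wrong) :
    n < Fintype.card κ + 2 * wrong.card := by
  let jump : Finset (Fin n) := {i | d i.castSucc < d i.succ}
  let wrongLeft : Finset (Fin n) := {i | i.castSucc ∈ wrong}
  let wrongRight : Finset (Fin n) := {i | i.succ ∈ wrong}
  have hcover : Finset.univ ⊆ jump ∪ (wrongLeft ∪ wrongRight) := by
    intro i _
    simpa [jump, wrongLeft, wrongRight, (hd i.castSucc_lt_succ.le).lt_iff_ne,
      or_iff_not_imp_left] using h i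
  have hjump : jump.card < Fintype.card κ := card_filter_castSucc_lt_succ_lt_card hd
  have hleft : wrongLeft.card ≤ wrong.card :=
    Finset.card_le_card_of_injOn Fin.castSucc (by simp [Set.MapsTo, wrongLeft])
      (Fin.castSucc_injective n).injOn
  have hright : wrongRight.card ≤ wrong.card :=
    Finset.card_le_card_of_injOn Fin.succ (by simp [Set.MapsTo, wrongRight])
      (Fin.succ_injective n).injOn
  have hn : n ≤ jump.card + (wrongLeft.card + wrongRight.card) := calc
    n = (Finset.univ : Finset (Fin n)).card := (Finset.card_fin n).symm
    _ ≤ (jump ∪ (wrongLeft ∪ wrongRight)).card := Finset.card_le_card hcover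
    _ ≤ _ := (Finset.card_union_le _ _).trans
      (Nat.add_le_add_left (Finset.card_union_le _ _) _)
  omega

lemma classificationError_eq_card_div {N : ℕ} (θ : ℝ) (x : Fin N → I) (y : Fin N → Fin 2)
    (g : I → ℝ) :
    classificationError θ x y g =
      (({i | thresholdLabel θ (g (x i)) ≠ y i} : Finset (Fin N)).card : ℝ) / N := by
  rw [classificationError, Finset.sum_boole, one_div_mul_eq_div]

lemma one_fourth_le_classificationError {κ : Type*} [LinearOrder κ] [Fintype κ] {n : ℕ} {θ : ℝ}
    {x : Fin (n + 1) → I} {y : Fin (n + 1) → Fin 2} {g : I → ℝ} {c : I → κ} (hx : Monotone x)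
    (hy : ∀ i : Fin n, y i.castSucc ≠ y i.succ) (hc : Monotone c)
    (hcg : ∀ z z', c z = c z' → thresholdLabel θ (g z) = thresholdLabel θ (g z'))
    (hn : 2 * Fintype.card κ ≤ n + 1) :
    1 / 4 ≤ classificationError θ x y g := by
  have hwrong := lt_card_add_two_mul_card (hc.comp hx)
    (wrong := {i | thresholdLabel θ (g (x i)) ≠ y i}) fun i hi => by
      by_contra! hcorrect
      simp only [Finset.mem_filter, Finset.mem_univ, true_and, not_not] at hcorrect
      exact hy i (hcorrect.1 ▸ hcorrect.2 ▸ hcg _ _ hi)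
  rw [classificationError_eq_card_div, div_le_div_iff₀ (by norm_num) (by positivity)]
  have hcard : n + 1 ≤ 4 * ({i | thresholdLabel θ (g (x i)) ≠ y i} : Finset _).card := by omega
  rify at hcard
  push_cast
  linarith

lemma classificationError_midpoint_eq_zero {N : ℕ} {a b : ℝ} (hab : a < b) {x : Fin N → I}
    {y : Fin N → Fin 2} {g : I → ℝ} (hg : ∀ i, g (x i) = if y i = 0 then a else b) :
    classificationError ((a + b) / 2) x y g = 0 := by
  have hcorrect (i : Fin N) : thresholdLabel ((a + b) / 2) (g (x i)) = y i := by
    rw [hg, thresholdLabel]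
    by_cases hi : y i = 0
    · rw [if_pos hi, if_neg (by linarith), hi]
    · rw [if_neg hi, if_pos (by linarith), Fin.eq_one_of_ne_zero _ hi]
  simp [classificationError, hcorrect]

lemma ReLUNetwork.one_fourth_le_classificationError {N l u : ℕ} (G : ReLUNetwork l u) (θ : ℝ)
    (hN : 4 * (u + 1) ^ l ≤ N) {x : Fin N → I} {y : Fin N → Fin 2} (hx : Monotone x)
    (hy : ∀ i, y i = if Even (i : ℕ) then 0 else 1) :
    1 / 4 ≤ classificationError θ x y fun z => G.eval (z : ℝ) := by
  obtain ⟨c, hc, hcG⟩ := G.isPiecewiseAffine_eval.exists_labelling_threshold θ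
  obtain ⟨n, rfl⟩ : ∃ n, N = n + 1 :=
    Nat.exists_eq_succ_of_ne_zero (by have : 0 < (u + 1) ^ l := by positivity
                                      omega)
  refine _root_.one_fourth_le_classificationError hx (fun i => ?_) (hc.comp (Subtype.mono_coe _))
    (fun z z' => hcG z z') (by rw [Fintype.card_fin]; omega)
  by_cases hi : Even (i : ℕ) <;> simp [hy, hi, Nat.even_add_one]

lemma four_mul_succ_pow_le_floor {ρ : ℝ} (hρ : 0 ≤ ρ) {k l u : ℕ} (hl : 1 ≤ l) (hu : 1 ≤ u)
    (h : (u : ℝ) ≤ ρ ^ ((k : ℝ) / l) / 8) : 4 * (u + 1) ^ l ≤ ⌊ρ ^ k⌋₊ := by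
  refine Nat.le_floor ?_
  push_cast
  have hu' : (1 : ℝ) ≤ u := by exact_mod_cast hu
  calc (4 : ℝ) * (u + 1) ^ l ≤ 4 ^ l * (2 * u) ^ l := by
        gcongr
        · exact le_self_pow₀ (by norm_num) (by omega)
        · linarith
    _ = (8 * u) ^ l := by rw [← mul_pow]; ring
    _ ≤ (ρ ^ ((k : ℝ) / l)) ^ l := by gcongr; linarith
    _ = ρ ^ k := by
        rw [← Real.rpow_mul_natCast hρ, div_mul_cancel₀ _ (by positivity), Real.rpow_natCast]

end Classification

section Sweeps

variable {α β : Type*}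

/-- `h` attains every value in `V` on each of `N` successive subsets of `s`. For `V = {a, b}` this
says that `h` crosses between `a` and `b` at least `N` times on `s`; consecutive subsets may share
a point. -/
def SweepsOn [Preorder α] (h : α → β) (V : Set β) (s : Set α) (N : ℕ) : Prop :=
  ∃ l : List (Set α), l.length = N ∧ (∀ B ∈ l, B ⊆ s ∧ V ⊆ h '' B) ∧
    l.Pairwise fun B C => ∀ x ∈ B, ∀ y ∈ C, x ≤ y

namespace SweepsOn

variable {h : α → β} {V : Set β}

lemma zero [Preorder α] (h : α → β) (V : Set β) (s : Set α) : SweepsOn h V s 0 :=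
  ⟨[], rfl, by simp, List.Pairwise.nil⟩

lemma one [Preorder α] {s : Set α} (hV : V ⊆ h '' s) : SweepsOn h V s 1 :=
  ⟨[s], rfl, by simpa using hV, List.pairwise_singleton _ _⟩

lemma mono [Preorder α] {s t : Set α} {N : ℕ} (H : SweepsOn h V s N) (hst : s ⊆ t) :
    SweepsOn h V t N := by
  obtain ⟨l, hlen, hl, hord⟩ := H
  exact ⟨l, hlen, fun B hB => ⟨(hl B hB).1.trans hst, (hl B hB).2⟩, hord⟩

lemma union [Preorder α] {s t : Set α} {M N : ℕ} (Hs : SweepsOn h V s M) (Ht : SweepsOn h V t N)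
    (hst : ∀ x ∈ s, ∀ y ∈ t, x ≤ y) : SweepsOn h V (s ∪ t) (M + N) := by
  obtain ⟨l, rfl, hl, hord⟩ := Hs
  obtain ⟨l', rfl, hl', hord'⟩ := Ht
  refine ⟨l ++ l', List.length_append, fun B hB => ?_, List.pairwise_append.mpr ⟨hord, hord',
    fun B hB C hC x hx y hy => hst x ((hl B hB).1 hx) y ((hl' C hC).1 hy)⟩⟩
  rcases List.mem_append.mp hB with hB | hB
  · exact ⟨(hl B hB).1.trans Set.subset_union_left, (hl B hB).2⟩
  · exact ⟨(hl' B hB).1.trans Set.subset_union_right, (hl' B hB).2⟩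

lemma biUnion [Preorder α] {ι : Type*} [LinearOrder ι] {s : ι → Set α} {N : ι → ℕ}
    (F : Finset ι) (H : ∀ i ∈ F, SweepsOn h V (s i) (N i))
    (hs : ∀ i j, i < j → ∀ x ∈ s i, ∀ y ∈ s j, x ≤ y) :
    SweepsOn h V (⋃ i ∈ F, s i) (∑ i ∈ F, N i) := by
  induction F using Finset.induction_on_max with
  | empty => exact zero _ _ _
  | insert j F hj ih =>
    rw [Finset.sum_insert fun hjF => (hj j hjF).false, add_comm, Finset.set_biUnion_insert,
      Set.union_comm]
    refine (ih fun i hi => H i (Finset.mem_insert_of_mem hi)).union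
      (H j (Finset.mem_insert_self j F)) fun x hx y hy => ?_
    obtain ⟨i, hi, hxi⟩ := Set.mem_iUnion₂.mp hx
    exact hs i j (hj i hi) x hxi y hy

/-- Where the preimages are chosen antitonically, the blocks are visited in reverse order. -/
lemma comp_of_rightInvOn [Preorder α] {γ : Type*} [Preorder γ] {g : γ → α} {ψ : α → γ}
    {s : Set α} {t : Set γ} {N : ℕ} (H : SweepsOn h V s N)
    (hψ : MonotoneOn ψ s ∨ AntitoneOn ψ s) (hmaps : Set.MapsTo ψ s t)
    (hinv : Set.RightInvOn ψ g s) : SweepsOn (h ∘ g) V t N := by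
  obtain ⟨l, hlen, hl, hord⟩ := H
  have himage : ∀ B ∈ l, ψ '' B ⊆ t ∧ V ⊆ (h ∘ g) '' (ψ '' B) := fun B hB => by
    refine ⟨(hmaps.mono_left (hl B hB).1).image_subset, ?_⟩
    rw [Set.image_comp, (hinv.mono (hl B hB).1).image_image]
    exact (hl B hB).2
  rcases hψ with hψ | hψ
  · refine ⟨l.map (ψ '' ·), by simpa using hlen, by simpa using himage, ?_⟩
    refine List.pairwise_map.mpr (hord.imp_of_mem fun hB hC hBC => ?_)
    rintro _ ⟨x, hx, rfl⟩ _ ⟨y, hy, rfl⟩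
    exact hψ ((hl _ hB).1 hx) ((hl _ hC).1 hy) (hBC x hx y hy)
  · refine ⟨(l.map (ψ '' ·)).reverse, by simpa using hlen, by simpa using himage, ?_⟩
    refine List.pairwise_reverse.mpr (List.pairwise_map.mpr
      (hord.imp_of_mem fun hB hC hBC => ?_))
    rintro _ ⟨y, hy, rfl⟩ _ ⟨x, hx, rfl⟩
    exact hψ ((hl _ hB).1 hx) ((hl _ hC).1 hy) (hBC x hx y hy)

end SweepsOn

section MonotoneSection

variable [ConditionallyCompleteLinearOrder α] [TopologicalSpace α] [OrderTopology α]
  [DenselyOrdered α] [LinearOrder β] [TopologicalSpace β] [OrderClosedTopology β]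
  {g : α → β} {c d : α}

/-- Take the least preimage in `[c, d]`: by the intermediate value theorem on `[c, ψ y']`, it does
not exceed `ψ y'` for `y ≤ y'`. -/
lemma exists_monotoneOn_rightInvOn_Icc (hg : Continuous g) (hcd : c ≤ d) :
    ∃ ψ : β → α, MonotoneOn ψ (Set.Icc (g c) (g d)) ∧
      Set.MapsTo ψ (Set.Icc (g c) (g d)) (Set.Icc c d) ∧
      Set.RightInvOn ψ g (Set.Icc (g c) (g d)) := by
  have hleast : ∀ y ∈ Set.Icc (g c) (g d), ∃ x, IsLeast (Set.Icc c d ∩ g ⁻¹' {y}) x := by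
    intro y hy
    obtain ⟨x, hx, hxy⟩ := intermediate_value_Icc hcd hg.continuousOn hy
    exact (isCompact_Icc.inter_right (isClosed_singleton.preimage hg)).exists_isLeast ⟨x, hx, hxy⟩
  choose! ψ hψ using hleast
  refine ⟨ψ, fun y hy y' hy' hyy' => ?_, fun y hy => (hψ y hy).1.1, fun y hy => (hψ y hy).1.2⟩
  obtain ⟨⟨hcψ, hψd⟩, hgψ⟩ := (hψ y' hy').1
  obtain ⟨x, hx, hxy⟩ := intermediate_value_Icc hcψ hg.continuousOn ⟨hy.1, hyy'.trans_eq hgψ.symm⟩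
  exact ((hψ y hy).2 ⟨⟨hx.1, hx.2.trans hψd⟩, hxy⟩).trans hx.2

lemma exists_monotoneOn_or_antitoneOn_rightInvOn_uIcc (hg : Continuous g) (hcd : c ≤ d) :
    ∃ ψ : β → α,
      (MonotoneOn ψ (Set.uIcc (g c) (g d)) ∨ AntitoneOn ψ (Set.uIcc (g c) (g d))) ∧
      Set.MapsTo ψ (Set.uIcc (g c) (g d)) (Set.Icc c d) ∧
      Set.RightInvOn ψ g (Set.uIcc (g c) (g d)) := by
  rcases le_total (g c) (g d) with hle | hle
  · rw [Set.uIcc_of_le hle]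
    obtain ⟨ψ, hψ, h⟩ := exists_monotoneOn_rightInvOn_Icc hg hcd
    exact ⟨ψ, Or.inl hψ, h⟩
  · rw [Set.uIcc_of_ge hle]
    obtain ⟨ψ, hψ, hmaps, hinv⟩ :=
      exists_monotoneOn_rightInvOn_Icc (continuous_toDual.comp hg) hcd
    exact ⟨ψ ∘ OrderDual.toDual, Or.inr fun y hy y' hy' hyy' => hψ hy'.symm hy.symm hyy',
      fun y hy => hmaps hy.symm, fun y hy => hinv hy.symm⟩

end MonotoneSection

namespace SweepsOn

variable {V : Set β}

lemma comp_of_uIcc {γ : Type*} [ConditionallyCompleteLinearOrder α] [TopologicalSpace α]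
    [OrderTopology α] [DenselyOrdered α] [LinearOrder γ] [TopologicalSpace γ]
    [OrderClosedTopology γ] {g : α → γ} {h : γ → β} {c d : α} {N : ℕ} (hg : Continuous g)
    (hcd : c ≤ d) (H : SweepsOn h V (Set.uIcc (g c) (g d)) N) :
    SweepsOn (h ∘ g) V (Set.Icc c d) N := by
  obtain ⟨ψ, hψ, hmaps, hinv⟩ := exists_monotoneOn_or_antitoneOn_rightInvOn_uIcc hg hcd
  exact H.comp_of_rightInvOn hψ hmaps hinv

/-- Pick the required value in each block; adjacent picks differ, so they increase strictly. -/
lemma exists_strictMono_alternating [PartialOrder α] {h : α → β} {a b : β} {s : Set α} {N : ℕ}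
    (hab : a ≠ b) (H : SweepsOn h {a, b} s N) :
    ∃ x : Fin N → α, StrictMono x ∧ ∀ i, h (x i) = if Even (i : ℕ) then a else b := by
  obtain ⟨l, rfl, hl, hord⟩ := H
  have hpick (i : Fin l.length) : ∃ x ∈ l[i], h x = if Even (i : ℕ) then a else b :=
    (hl l[i] (List.getElem_mem i.2)).2 (by split_ifs <;> simp)
  choose x hxl hx using hpick
  have hle (i j : Fin l.length) (hij : i < j) : x i ≤ x j :=
    List.pairwise_iff_getElem.mp hord i j i.2 j.2 hij (x i) (hxl i) (x j) (hxl j)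
  refine ⟨x, ?_, hx⟩
  clear hxl
  generalize l.length = N at x hx hle
  cases N with
  | zero => exact Subsingleton.strictMono x
  | succ n =>
    refine Fin.strictMono_iff_lt_succ.mpr fun i =>
      (hle _ _ i.castSucc_lt_succ).lt_of_ne fun heq => ?_
    have hvalue := (hx i.castSucc).symm.trans ((congrArg h heq).trans (hx i.succ))
    by_cases hi : Even (i : ℕ) <;> simp [hi, Nat.even_add_one, hab, hab.symm] at hvalue

end SweepsOn

end Sweeps

section Covering

variable {q : ℕ} {f : Fin (q + 1) → Fin (q + 1)} {τ : Equiv.Perm (Fin (q + 1))} {J v w : Fin q}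
  {r s t : Fin (q + 1)} {k : ℕ}

/-- The basic interval `v`, which joins the consecutive points `v.castSucc` and `v.succ`, lies
between the points `s` and `t` (in either order). -/
def Separates (v : Fin q) (s t : Fin (q + 1)) : Prop :=
  ¬(v.castSucc < s ↔ v.castSucc < t)

/-- The image of the basic interval `w` under a continuous extension of `f` must cover the basic
interval `v`. -/
def Covers (f : Fin (q + 1) → Fin (q + 1)) (w v : Fin q) : Prop :=
  Separates v (f w.castSucc) (f w.succ)

open Classical in
/-- The adjacency matrix of the covering graph of `f` (the Markov graph, when `f` permutes the
points of a cycle): the entry at `(w, v)` is `1` if `w` covers `v`, and `0` otherwise. -/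
noncomputable def coverMatrix (f : Fin (q + 1) → Fin (q + 1)) : Matrix (Fin q) (Fin q) ℕ :=
  Matrix.of fun w v => if Covers f w v then 1 else 0

/-- The number of paths of length `k` in the covering graph of `f` that end at `v`. -/
noncomputable def pathCount (f : Fin (q + 1) → Fin (q + 1)) (k : ℕ) (v : Fin q) : ℕ :=
  ∑ w, (coverMatrix f ^ k) w v

/-- `f` moves the endpoints of `J` to opposite sides of `J`, exchanging their order. -/
def Flips (f : Fin (q + 1) → Fin (q + 1)) (J : Fin q) : Prop :=
  J.castSucc < f J.castSucc ∧ f J.succ ≤ J.castSucc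

/-- In the covering graph of `f`, paths of length `k` lead from `J` to all the basic intervals
between `s` and `t`. For fixed `k` this is an equivalence relation in `s` and `t`. -/
def PathsSpan (f : Fin (q + 1) → Fin (q + 1)) (J : Fin q) (k : ℕ) (s t : Fin (q + 1)) : Prop :=
  ∀ v, Separates v s t → 0 < (coverMatrix f ^ k) J v

lemma separates_castSucc_succ_iff : Separates v w.castSucc w.succ ↔ v = w := by
  rw [Separates, Fin.castSucc_lt_castSucc_iff, Fin.castSucc_lt_succ_iff]
  grind

lemma exists_separates_of_not_iff {Q : Fin (q + 1) → Prop} (h : ¬(Q s ↔ Q t)) :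
    ∃ w, Separates w s t ∧ ¬(Q w.castSucc ↔ Q w.succ) := by
  by_contra! hconst
  wlog hst : s ≤ t generalizing s t
  · exact this (by tauto) (fun w hw => hconst w (by rw [Separates] at *; tauto))
      (le_of_not_ge hst)
  have hQ (r : Fin (q + 1)) : s ≤ r → r ≤ t → (Q s ↔ Q r) := by
    induction r using Fin.induction with
    | zero => intro hs _; rw [Fin.le_zero_iff.mp hs]
    | succ w ih =>
      intro hs ht
      rcases hs.eq_or_lt with rfl | hs
      · rfl
      have hsw : s ≤ w.castSucc := Fin.le_castSucc_iff.mpr hs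
      have hwt : w.castSucc < t := w.castSucc_lt_succ.trans_le ht
      exact (ih hsw hwt.le).trans (hconst w fun hiff => hsw.not_gt (hiff.mpr hwt))
  exact h (hQ t hst le_rfl)

lemma Separates.exists_covers (h : Separates v (f s) (f t)) :
    ∃ w, Separates w s t ∧ Covers f w v :=
  exists_separates_of_not_iff (Q := fun r => v.castSucc < f r) h

lemma exists_covers (hf : f.Surjective) (v : Fin q) : ∃ w, Covers f w v := by
  obtain ⟨s, hs⟩ := hf v.castSucc
  obtain ⟨t, ht⟩ := hf v.succ
  have hv : Separates v (f s) (f t) := by rw [hs, ht, separates_castSucc_succ_iff]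
  exact hv.exists_covers.imp fun w hw => hw.2

lemma coverMatrix_apply_of_covers (h : Covers f w v) : coverMatrix f w v = 1 :=
  if_pos h

lemma exists_flips (hf : ∀ i, f i ≠ i) : ∃ J, Flips f J := by
  by_contra! hflip
  simp only [Flips, not_and, not_le] at hflip
  have hlt (i : Fin (q + 1)) : i < f i := by
    induction i using Fin.induction with
    | zero => exact Fin.pos_of_ne_zero (hf 0)
    | succ i ih => exact (Fin.castSucc_lt_iff_succ_le.mp (hflip i ih)).lt_of_ne (hf _).symm
  exact (Fin.le_last _).not_gt (hlt (Fin.last q))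

lemma Flips.covers_self (hJ : Flips f J) : Covers f J J :=
  fun h => hJ.2.not_gt (h.mp hJ.1)

/-- Otherwise `τ` would exchange the points on the two sides of `J`, and their total number
`q + 1` would be even. -/
lemma Flips.exists_ne_covers (hJ : Flips τ J) (hq : Even q) : ∃ w ≠ J, Covers τ w J := by
  by_contra! honly
  have hside (r s : Fin (q + 1)) (h : ¬(J.castSucc < τ r ↔ J.castSucc < τ s)) :
      Separates J r s := by
    obtain ⟨w, hw, hwJ⟩ := Separates.exists_covers h
    rwa [← not_imp_not.mp (honly w) hwJ]
  have hswap (r : Fin (q + 1)) : r ≤ J.castSucc ↔ J.castSucc < τ r := by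
    refine ⟨fun hr => ?_, fun hr => ?_⟩
    · by_contra hτr
      exact hside r J.castSucc (fun h => hτr (h.mpr hJ.1)) (by simp [hr])
    · by_contra! hlt
      exact hside r J.succ (fun h => hJ.2.not_gt (h.mp hr)) (by simp [hlt])
  have hcard : (Finset.Iic J.castSucc).card = (Finset.Ioi J.castSucc).card :=
    Finset.card_equiv τ (by simpa using hswap)
  rw [Fin.card_Iic, Fin.card_Ioi, Fin.val_castSucc] at hcard
  grind

namespace PathsSpan

lemma symm (h : PathsSpan f J k s t) : PathsSpan f J k t s :=
  fun v hv => h v (mt Iff.symm hv)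

lemma trans (hrs : PathsSpan f J k r s) (hst : PathsSpan f J k s t) : PathsSpan f J k r t := by
  intro v hv
  by_cases hrsv : Separates v r s
  · exact hrs v hrsv
  · exact hst v fun h => hv ((not_not.mp hrsv).trans h)

lemma refl : PathsSpan f J k s s :=
  fun _ hv => absurd Iff.rfl hv

lemma zero : PathsSpan f J 0 J.castSucc J.succ := by
  intro v hv
  simp [separates_castSucc_succ_iff.mp hv]

lemma map (h : PathsSpan f J k s t) : PathsSpan f J (k + 1) (f s) (f t) := by
  intro v hv
  obtain ⟨w, hw, hwv⟩ := hv.exists_covers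
  rw [pow_succ, Matrix.mul_apply]
  refine Finset.sum_pos' (fun _ _ => Nat.zero_le _) ⟨w, Finset.mem_univ w, ?_⟩
  rw [coverMatrix_apply_of_covers hwv, mul_one]
  exact h w hw

lemma succ (hJ : Covers f J J) (h : PathsSpan f J k s t) : PathsSpan f J (k + 1) s t := by
  intro v hv
  rw [pow_succ', Matrix.mul_apply]
  refine Finset.sum_pos' (fun _ _ => Nat.zero_le _) ⟨J, Finset.mem_univ J, ?_⟩
  rw [coverMatrix_apply_of_covers hJ, one_mul]
  exact h v hv

lemma castSucc_apply (hJ : Flips f J) (k : ℕ) :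
    PathsSpan f J (k + 1) J.castSucc (f J.castSucc) := by
  induction k with
  | zero =>
    intro v hv
    have hcovers : Covers f J v := by
      simp only [Covers, Separates] at hv ⊢
      have := hJ.1
      have := hJ.2
      grind
    rw [zero_add, pow_one, coverMatrix_apply_of_covers hcovers]
    exact one_pos
  | succ k ih => exact ih.succ hJ.covers_self

lemma castSucc_iterate (hJ : Flips f J) {j : ℕ} (hjk : j ≤ k) :
    PathsSpan f J k J.castSucc (f^[j] J.castSucc) ∧
      PathsSpan f J k J.castSucc (f^[j] J.succ) := by
  induction k generalizing j with
  | zero =>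
    obtain rfl := Nat.le_zero.mp hjk
    exact ⟨refl, zero⟩
  | succ k ih =>
    cases j with
    | zero => exact ⟨refl, (ih (Nat.zero_le k)).2.succ hJ.covers_self⟩
    | succ j =>
      have hj := ih (Nat.le_of_succ_le_succ hjk)
      rw [Function.iterate_succ_apply', Function.iterate_succ_apply']
      exact ⟨(castSucc_apply hJ k).trans hj.1.map, (castSucc_apply hJ k).trans hj.2.map⟩

end PathsSpan

/-- After `k` steps, the points linked to the left end of `J` include the first `k` images of both
ends, and the right end of `J` is itself an image of the left one. -/
lemma Flips.pathsSpan (hJ : Flips τ J) (hτ : τ.IsCycleOn Set.univ) (s : Fin (q + 1)) :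
    PathsSpan τ J (q - 1) J.castSucc s := by
  have hiterate (t : Fin (q + 1)) : ∃ j < q + 1, τ^[j] J.castSucc = t := by
    rw [← Finset.coe_univ] at hτ
    simpa [← Equiv.Perm.iterate_eq_pow] using
      hτ.exists_pow_eq (Finset.mem_univ J.castSucc) (Finset.mem_univ t)
  obtain ⟨j, hj, rfl⟩ := hiterate s
  obtain ⟨r, hr, hrJ⟩ := hiterate J.succ
  have hr0 : r ≠ 0 := by
    rintro rfl
    exact J.castSucc_lt_succ.ne hrJ
  rcases lt_or_ge j q with hjq | hjq
  · exact (PathsSpan.castSucc_iterate hJ (by omega)).1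
  · obtain ⟨i, rfl⟩ := Nat.exists_eq_add_of_le' (show r ≤ j by omega)
    rw [Function.iterate_add_apply, hrJ]
    exact (PathsSpan.castSucc_iterate hJ (by omega)).2

lemma Flips.coverMatrix_pow_pos (hJ : Flips τ J) (hτ : τ.IsCycleOn Set.univ) (v : Fin q) :
    0 < (coverMatrix τ ^ (q - 1)) J v :=
  (hJ.pathsSpan hτ v.castSucc).symm.trans (hJ.pathsSpan hτ v.succ) v
    (separates_castSucc_succ_iff.mpr rfl)

lemma pathCount_zero (f : Fin (q + 1) → Fin (q + 1)) (v : Fin q) : pathCount f 0 v = 1 := by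
  simp [pathCount, Matrix.one_apply]

lemma pathCount_add (f : Fin (q + 1) → Fin (q + 1)) (k r : ℕ) (v : Fin q) :
    pathCount f (k + r) v = ∑ w, pathCount f k w * (coverMatrix f ^ r) w v := by
  simp only [pathCount, pow_add, Matrix.mul_apply, Finset.sum_mul]
  exact Finset.sum_comm

lemma pathCount_le_pathCount_add {r : ℕ} (h : 0 < (coverMatrix f ^ r) w v) :
    pathCount f k w ≤ pathCount f (k + r) v := by
  rw [pathCount_add]
  exact (Nat.le_mul_of_pos_right _ h).trans
    (Finset.single_le_sum (f := fun w => pathCount f k w * (coverMatrix f ^ r) w v)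
      (fun _ _ => Nat.zero_le _) (Finset.mem_univ w))

lemma pathCount_pos (hf : f.Surjective) (k : ℕ) (v : Fin q) : 0 < pathCount f k v := by
  induction k generalizing v with
  | zero => exact (pathCount_zero f v).symm ▸ one_pos
  | succ k ih =>
    obtain ⟨w, hw⟩ := exists_covers hf v
    refine (ih w).trans_le (pathCount_le_pathCount_add ?_)
    rw [pow_one, coverMatrix_apply_of_covers hw]
    exact one_pos

lemma add_le_pathCount_succ (hJ : Covers f J J) (hwJ : w ≠ J) (hw : Covers f w J) :
    pathCount f k J + pathCount f k w ≤ pathCount f (k + 1) J := by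
  rw [pathCount_add, pow_one]
  have h := Finset.add_le_sum (f := fun w => pathCount f k w * coverMatrix f w J)
    (fun _ _ => Nat.zero_le _) (Finset.mem_univ J) (Finset.mem_univ w) hwJ.symm
  simpa [coverMatrix_apply_of_covers hJ, coverMatrix_apply_of_covers hw] using h

lemma pow_le_of_delayed_add_le {ρ : ℝ} {r : ℕ} {u : ℕ → ℕ} (hρ1 : 1 ≤ ρ)
    (hρ : ρ ^ (r + 1) = ρ ^ r + 1) (h0 : 1 ≤ u 0) (hsucc : ∀ k < r, u k + 1 ≤ u (k + 1))
    (hadd : ∀ k, u (k + r) + u k ≤ u (k + r + 1)) (k : ℕ) : ρ ^ k ≤ u k := by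
  rify at h0 hsucc hadd
  induction k using Nat.strong_induction_on with
  | _ k ih =>
  rcases k with - | k
  · simpa using h0
  rcases lt_or_ge k r with hk | hk
  · have hstep : ρ ^ (k + 1) - ρ ^ k ≤ ρ ^ (r + 1) - ρ ^ r := by
      have := mul_le_mul_of_nonneg_right (pow_le_pow_right₀ hρ1 hk.le) (sub_nonneg.mpr hρ1)
      linear_combination this
    linarith [ih k k.lt_succ_self, hsucc k (by exact_mod_cast hk)]
  · obtain ⟨j, rfl⟩ := Nat.exists_eq_add_of_le' hk
    have hrec : ρ ^ (j + r + 1) = ρ ^ (j + r) + ρ ^ j := by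
      rw [add_assoc, pow_add, hρ, pow_add]
      ring
    linarith [ih (j + r) (Nat.lt_succ_self _), ih j (by omega), hadd j]

lemma Flips.pow_le_pathCount (hJ : Flips τ J) (hτ : τ.IsCycleOn Set.univ) (hq : Even q) {ρ : ℝ}
    (hρ1 : 1 ≤ ρ) (hρ : ρ ^ q = ρ ^ (q - 1) + 1) (k : ℕ) : ρ ^ k ≤ pathCount τ k J := by
  obtain ⟨w, hwJ, hw⟩ := hJ.exists_ne_covers hq
  have hstep (k : ℕ) := add_le_pathCount_succ (k := k) hJ.covers_self hwJ hw
  have hq1 : q - 1 + 1 = q := Nat.sub_add_cancel J.pos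
  refine pow_le_of_delayed_add_le (u := fun k => pathCount τ k J) hρ1 (hq1.symm ▸ hρ)
    (pathCount_zero _ _).ge (fun k _ => ?_) (fun k => ?_) k
  · exact (Nat.add_le_add_left (pathCount_pos τ.surjective k w) _).trans (hstep k)
  · exact (Nat.add_le_add_left
      (pathCount_le_pathCount_add (hJ.coverMatrix_pow_pos hτ w)) _).trans (hstep _)

end Covering

section Cycle

lemma isCycleOn_finRotate (n : ℕ) : (finRotate n).IsCycleOn Set.univ := by
  match n with
  | 0 | 1 => exact Equiv.Perm.isCycleOn_of_subsingleton _ _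
  | n + 2 =>
    simpa [Set.eq_univ_iff_forall] using (isCycle_finRotate (n := n)).isCycleOn

lemma exists_strictMono_isCycleOn {α : Type*} [LinearOrder α] {g : α → α} {x₀ : α} {n : ℕ}
    (hx₀ : Function.minimalPeriod g x₀ = n + 1) :
    ∃ (x : Fin (n + 1) → α) (τ : Equiv.Perm (Fin (n + 1))), StrictMono x ∧
      τ.IsCycleOn Set.univ ∧ ∀ i, g (x i) = x (τ i) := by
  let y (i : Fin (n + 1)) : α := g^[i] x₀
  have hy : y.Injective := fun i j hij => Fin.ext <|
    Function.iterate_injOn_Iio_minimalPeriod (i.2.trans_eq hx₀.symm) (j.2.trans_eq hx₀.symm) hij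
  have hgy (i : Fin (n + 1)) : g (y i) = y (finRotate (n + 1) i) := by
    rw [finRotate_apply]
    simp only [y, Fin.val_add, Fin.val_one', Nat.add_mod_mod, ← hx₀,
      Function.iterate_mod_minimalPeriod_eq, Function.iterate_succ_apply']
  refine ⟨y ∘ Tuple.sort y, (Tuple.sort y)⁻¹ * finRotate (n + 1) * Tuple.sort y,
    (Tuple.monotone_sort y).strictMono_of_injective (hy.comp (Tuple.sort y).injective), ?_,
    fun i => by simp [hgy]⟩
  simpa using (isCycleOn_finRotate (n + 1)).conj (g := (Tuple.sort y)⁻¹)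

end Cycle

section Iterates

variable {α : Type*} {q : ℕ} {f : Fin (q + 1) → Fin (q + 1)} {g : α → α} {x : Fin (q + 1) → α}

lemma Separates.Icc_subset_uIcc [Lattice α] {v : Fin q} {s t : Fin (q + 1)} (h : Separates v s t)
    (hx : Monotone x) : Set.Icc (x v.castSucc) (x v.succ) ⊆ Set.uIcc (x s) (x t) := by
  have hcases : s ≤ v.castSucc ∧ v.succ ≤ t ∨ t ≤ v.castSucc ∧ v.succ ≤ s := by
    simp only [Separates, Fin.castSucc_lt_iff_succ_le, Fin.le_castSucc_iff] at h ⊢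
    grind
  rcases hcases with ⟨hs, ht⟩ | ⟨ht, hs⟩
  · exact (Set.Icc_subset_Icc (hx hs) (hx ht)).trans Set.Icc_subset_uIcc
  · exact (Set.Icc_subset_Icc (hx ht) (hx hs)).trans Set.Icc_subset_uIcc'

lemma Icc_castSucc_succ_le [Preorder α] (hx : Monotone x) {v w : Fin q} (hvw : v < w) :
    ∀ y ∈ Set.Icc (x v.castSucc) (x v.succ), ∀ z ∈ Set.Icc (x w.castSucc) (x w.succ), y ≤ z :=
  fun _ hy _ hz => hy.2.trans ((hx (Fin.succ_le_castSucc_iff.mpr hvw)).trans hz.1)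

variable [ConditionallyCompleteLinearOrder α] [TopologicalSpace α] [OrderTopology α]
  [DenselyOrdered α]

lemma sweepsOn_iterate (hg : Continuous g) (hx : Monotone x) (hgx : ∀ i, g (x i) = x (f i))
    (k : ℕ) (w v : Fin q) :
    SweepsOn g^[k] {x v.castSucc, x v.succ} (Set.Icc (x w.castSucc) (x w.succ))
      ((coverMatrix f ^ k) w v) := by
  induction k generalizing w with
  | zero =>
    by_cases hwv : w = v
    · subst hwv
      simpa using SweepsOn.one (h := id) (Set.pair_subset
        ⟨_, Set.left_mem_Icc.mpr (hx w.castSucc_lt_succ.le), rfl⟩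
        ⟨_, Set.right_mem_Icc.mpr (hx w.castSucc_lt_succ.le), rfl⟩)
    · simpa [hwv] using SweepsOn.zero _ _ _
  | succ k ih =>
    classical
    have hcovered := SweepsOn.biUnion {u | Covers f w u} (fun u _ => ih u)
      fun _ _ => Icc_castSucc_succ_le hx
    rw [pow_succ', Matrix.mul_apply, Function.iterate_succ]
    simp only [coverMatrix, Matrix.of_apply, ite_mul, one_mul, zero_mul, ← Finset.sum_filter]
    refine SweepsOn.comp_of_uIcc hg (hx w.castSucc_lt_succ.le) (hcovered.mono ?_)
    rw [hgx, hgx]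
    exact Set.iUnion₂_subset fun u hu =>
      Separates.Icc_subset_uIcc (Finset.mem_filter.mp hu).2 hx

lemma sweepsOn_iterate_univ (hg : Continuous g) (hx : Monotone x) (hgx : ∀ i, g (x i) = x (f i))
    (k : ℕ) (v : Fin q) :
    SweepsOn g^[k] {x v.castSucc, x v.succ} Set.univ (pathCount f k v) :=
  (SweepsOn.biUnion Finset.univ (fun w _ => sweepsOn_iterate hg hx hgx k w v)
    fun _ _ => Icc_castSucc_succ_le hx).mono (Set.subset_univ _)

theorem exists_alternating_iterate (hg : Continuous g) {x₀ : α} {p : ℕ} (hp : Odd p)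
    (hp1 : 1 < p) (hx₀ : Function.minimalPeriod g x₀ = p) {ρ : ℝ} (hρ1 : 1 ≤ ρ)
    (hρ : ρ ^ (p - 1) = ρ ^ (p - 2) + 1) :
    ∃ a b : α, a < b ∧ ∀ k : ℕ, ∃ z : Fin ⌊ρ ^ k⌋₊ → α, StrictMono z ∧
      ∀ i, g^[k] (z i) = if Even (i : ℕ) then a else b := by
  obtain ⟨q, rfl⟩ : ∃ q, p = q + 1 := Nat.exists_eq_succ_of_ne_zero (by omega)
  obtain ⟨x, τ, hx, hτ, hgx⟩ := exists_strictMono_isCycleOn hx₀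
  have : Nontrivial (Fin (q + 1)) := Fin.nontrivial_iff_two_le.mpr hp1
  obtain ⟨J, hJ⟩ := exists_flips fun i => hτ.apply_ne Set.nontrivial_univ (Set.mem_univ i)
  refine ⟨x J.castSucc, x J.succ, hx J.castSucc_lt_succ, fun k => ?_⟩
  have hcount : ⌊ρ ^ k⌋₊ ≤ pathCount τ k J := Nat.floor_le_of_le <|
    hJ.pow_le_pathCount hτ (by simpa [Nat.odd_add_one] using hp) hρ1 hρ k
  obtain ⟨z, hz, hgz⟩ := (sweepsOn_iterate_univ hg hx.monotone hgx k
    J).exists_strictMono_alternating (hx J.castSucc_lt_succ).ne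
  exact ⟨z ∘ Fin.castLE hcount, hz.comp (Fin.strictMono_castLE hcount), fun i => hgz _⟩

end Iterates

theorem theorem4p1_general
    (f : unitInterval → unitInterval) (hf : Continuous f)
    (m p : ℕ) (hm : 0 < m) (hp : Odd p) (hp1 : 1 < p)
    (hcycle : ∃ x₀ : unitInterval, Function.minimalPeriod f x₀ = m * p)
    (ρ : ℝ) (hρ1 : 1 < ρ) (hρ : ρ ^ (p - 1) - ρ ^ (p - 2) - 1 = 0) :
    ∃ a b : unitInterval, a < b ∧
      ∀ k : ℕ,
        ∃ (x : Fin ⌊ρ ^ k⌋₊ → unitInterval) (y : Fin ⌊ρ ^ k⌋₊ → Fin 2),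
          StrictMono x ∧
          (∀ i, y i = if Even (i : ℕ) then 0 else 1) ∧
          (∀ i, f^[m * k] (x i) = if y i = 0 then a else b) ∧
          classificationError (((a : ℝ) + (b : ℝ)) / 2) x y
            (fun z => ((f^[m * k] z : unitInterval) : ℝ)) = 0 ∧
          ∀ l u : ℕ, 1 ≤ l → 1 ≤ u → (u : ℝ) ≤ ρ ^ ((k : ℝ) / (l : ℝ)) / 8 →
            ∀ G : ReLUNetwork l u,
              1 / 4 ≤ classificationError (((a : ℝ) + (b : ℝ)) / 2) x y
                (fun z => G.eval (z : ℝ)) := by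
  obtain ⟨x₀, hx₀⟩ := hcycle
  have hperiod : Function.minimalPeriod f^[m] x₀ = p := by
    rw [Function.minimalPeriod_iterate_eq_div_gcd hm.ne', hx₀, Nat.gcd_mul_right_left,
      Nat.mul_div_cancel_left p hm]
  obtain ⟨a, b, hab, halt⟩ :=
    exists_alternating_iterate (hf.iterate m) hp hp1 hperiod hρ1.le (by linarith)
  refine ⟨a, b, hab, fun k => ?_⟩
  obtain ⟨x, hx, hfx⟩ := halt k
  have hlabel (i : Fin ⌊ρ ^ k⌋₊) :
      f^[m * k] (x i) = if (if Even (i : ℕ) then 0 else 1 : Fin 2) = 0 then a else b := by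
    rw [Function.iterate_mul, hfx]
    split_ifs <;> simp_all
  refine ⟨x, fun i => if Even (i : ℕ) then 0 else 1, hx, fun _ => rfl, hlabel,
    classificationError_midpoint_eq_zero hab fun i => ?_, fun l u hl hu hlu G => ?_⟩
  · rw [hlabel, apply_ite Subtype.val]
  · exact G.one_fourth_le_classificationError _
      (four_mul_succ_pow_le_floor (zero_le_one.trans hρ1.le) hl hu hlu) hx.monotone fun _ => rfl

theorem theorem4p1
    (f : unitInterval → unitInterval) (hf : Continuous f)
    (m p : ℕ) (hm : ∃ s : ℕ, m = 2 ^ s) (hp : Odd p) (hp1 : 1 < p)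
    (hcycle : ∃ x₀ : unitInterval, Function.minimalPeriod f x₀ = m * p)
    (ρ : ℝ) (hρ1 : 1 < ρ) (hρ : ρ ^ (p - 1) - ρ ^ (p - 2) - 1 = 0) :
    ∃ a b : unitInterval, a < b ∧
      ∀ k : ℕ, 1 ≤ k →
        ∃ (x : Fin ⌊ρ ^ k⌋₊ → unitInterval) (y : Fin ⌊ρ ^ k⌋₊ → Fin 2),
          StrictMono x ∧
          (∀ i, y i = if Even (i : ℕ) then 0 else 1) ∧
          (∀ i, f^[m * k] (x i) = if y i = 0 then a else b) ∧
          classificationError (((a : ℝ) + (b : ℝ)) / 2) x y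
            (fun z => ((f^[m * k] z : unitInterval) : ℝ)) = 0 ∧
          ∀ l u : ℕ, 1 ≤ l → 1 ≤ u → (u : ℝ) ≤ ρ ^ ((k : ℝ) / (l : ℝ)) / 8 →
            ∀ G : ReLUNetwork l u,
              1 / 4 ≤ classificationError (((a : ℝ) + (b : ℝ)) / 2) x y
                (fun z => G.eval (z : ℝ)) := by
  obtain ⟨s, rfl⟩ := hm
  obtain ⟨a, b, hab, h⟩ :=
    theorem4p1_general f hf (2 ^ s) p (Nat.two_pow_pos s) hp hp1 hcycle ρ hρ1 hρ
  exact ⟨a, b, hab, fun k _ => h k⟩
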